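/- Let $H$ be an infinite-dimensional separable real Hilbert space and let $L$ be a positive self-adjoint (hence closed and densely defined) operator in $H$ which has an orthonormal basis $(\varphi_i)_{i\in\mathbb N}$ of $H$ consisting of eigenvectors, with eigenvalues $(\lambda_i)_{i\in\mathbb N}$. Let $$V=D(L^{1/2})=\Big\{v\in H:\ \|v\|_V^2:=\|L^{1/2}v\|_H^2=\sum_i\lambda_i(v,\varphi_i)_H^2<\infty\Big\},$$ assume that $V$ is continuously embedded in $H$, and let $V'$ be the dual of $V$ with the dual norm, where $V\hookrightarrow H\cong H'\hookrightarrow V'$ via $\langle v,w\rangle_V=(v,w)_H$. For $T\in(0,\infty]$ let $$W(0,T;V,V')=\{z\in L^2(0,T;V): z'\in L^2(0,T;V')\},\qquad \|z\|_{W(0,T;V,V')}^2=\|z\|_{L^2(0,T;V)}^2+\|z'\|_{L^2(0,T;V')}^2,$$ where $z'$ is the weak (distributional) derivative in $V'$. For an integer $N\ge 1$ let $H(N)=\bigotimes_{j=1}^N H$ be the Hilbert space tensor power, and let $V_1^0(N)=\bigcap_{i=1}^N\bigotimes_{j=1}^N V^{\delta_{ij}}$ (with $V^0=H$, $V^1=V$),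 i.e. the space of all $v\in H(N)$ with $$\|v\|_{V_1^0(N)}^2:=\sum_{\vec i\in\mathbb N^N}(\lambda_{i_1}+\dots+\lambda_{i_N})\,(v,\varphi_{i_1}\otimes\cdots\otimes\varphi_{i_N})_{H(N)}^2<\infty .$$ Let $T\in(0,\infty]$ and $z\in W(0,T;V,V')$. Then $z$ has a representative that is continuous from $[0,T)$ to $H$, so that $z(0)\in H$ is well defined, and for every integer $N\ge1$ the function $t\mapsto\bigotimes^N z(t)=z(t)\otimes\cdots\otimes z(t)$ belongs to $L^2(0,T;V_1^0(N))$ and $$\Big\|\bigotimes^N z\Big\|_{L^2(0,T;V_1^0(N))}\le\sqrt N\,\big(\|z(0)\|_H+\|z\|_{W(0,T;V,V')}\big)^N .$$ -/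

import Mathlib

open MeasureTheory Filter Topology
open scoped RealInnerProductSpace TensorProduct ContDiff

noncomputable section

namespace Carleman

/-! ### The Hilbert space tensor power `H(N) = H ⊗ ⋯ ⊗ H` -/

section TensorPower

variable (H : Type*) [NormedAddCommGroup H] [InnerProductSpace ℝ H] (N : ℕ)

/-- The algebraic `N`-fold tensor power of `H`
(a type synonym, since it carries the norm of the inner product below). -/
def AlgTensorPower : Type _ := ⨂[ℝ] (_ : Fin N), H

instance : AddCommGroup (AlgTensorPower H N) :=
  inferInstanceAs (AddCommGroup (⨂[ℝ] (_ : Fin N), H))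

instance : Module ℝ (AlgTensorPower H N) :=
  inferInstanceAs (Module ℝ (⨂[ℝ] (_ : Fin N), H))

variable {H N}

/-- The pure tensor `h₁ ⊗ ⋯ ⊗ h_N` in the algebraic tensor power. -/
def algTprod : MultilinearMap ℝ (fun _ : Fin N => H) (AlgTensorPower H N) :=
  PiTensorProduct.tprod ℝ

theorem span_algTprod :
    Submodule.span ℝ (Set.range (algTprod (H := H) (N := N))) = ⊤ :=
  PiTensorProduct.span_tprod_eq_top

variable (H N)

/-- The bilinear form on the algebraic tensor power determined by
`⟨g₁ ⊗ ⋯ ⊗ g_N, h₁ ⊗ ⋯ ⊗ h_N⟩ = ∏ⱼ ⟨gⱼ, hⱼ⟩`. -/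
def tensorForm : AlgTensorPower H N →ₗ[ℝ] AlgTensorPower H N →ₗ[ℝ] ℝ :=
  (PiTensorProduct.dualDistrib (R := ℝ) (M := fun _ : Fin N => H)) ∘ₗ
    PiTensorProduct.map (fun _ => (innerₛₗ ℝ : H →ₗ[ℝ] H →ₗ[ℝ] ℝ))

variable {H N}

theorem tensorForm_tprod (g h : Fin N → H) :
    tensorForm H N (algTprod g) (algTprod h) = ∏ j, ⟪g j, h j⟫ := by
  change PiTensorProduct.dualDistrib
    (PiTensorProduct.map (fun _ => (innerₛₗ ℝ : H →ₗ[ℝ] H →ₗ[ℝ] ℝ)) (PiTensorProduct.tprod ℝ g))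
    (PiTensorProduct.tprod ℝ h) = _
  rw [PiTensorProduct.map_tprod]
  exact PiTensorProduct.dualDistrib_apply (R := ℝ) (M := fun _ : Fin N => H) _ _

theorem tensorForm_symm (x y : AlgTensorPower H N) :
    tensorForm H N x y = tensorForm H N y x := by
  have hx : x ∈ Submodule.span ℝ (Set.range (algTprod (H := H) (N := N))) := by
    rw [span_algTprod]; trivial
  have hy : y ∈ Submodule.span ℝ (Set.range (algTprod (H := H) (N := N))) := by
    rw [span_algTprod]; trivial
  induction hx, hy using Submodule.span_induction₂ with
  | mem_mem x y hx hy =>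
    obtain ⟨g, rfl⟩ := hx
    obtain ⟨h, rfl⟩ := hy
    simp only [tensorForm_tprod, real_inner_comm]
  | zero_left => simp
  | zero_right => simp
  | add_left x y z _ _ _ h1 h2 => simp [h1, h2]
  | add_right x y z _ _ _ h1 h2 => simp [h1, h2]
  | smul_left r x y _ _ h => simp [h]
  | smul_right r x y _ _ h => simp [h]

theorem posSemidef_prod_gram {n : ℕ} (g : Fin n → Fin N → H) (s : Finset (Fin N)) :
    (Matrix.of fun a b : Fin n => ∏ j ∈ s, ⟪g a j, g b j⟫).PosSemidef := by
  classical
  induction s using Finset.induction_on with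
  | empty =>
    have := Matrix.posSemidef_vecMulVec_self_star (fun _ : Fin n => (1 : ℝ))
    convert this using 1
    ext a b
    simp [Matrix.vecMulVec]
  | insert k s hk ih =>
    have h := (Matrix.posSemidef_gram ℝ (fun a => g a k)).hadamard ih
    have e : (Matrix.of fun a b : Fin n => ∏ j ∈ insert k s, ⟪g a j, g b j⟫) =
        (Matrix.gram ℝ fun a => g a k).hadamard
          (Matrix.of fun a b => ∏ j ∈ s, ⟪g a j, g b j⟫) := by
      ext a b
      simp [Matrix.hadamard, Matrix.gram_apply, Finset.prod_insert hk]
    rw [e]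
    exact h

theorem tensorForm_nonneg (x : AlgTensorPower H N) : 0 ≤ tensorForm H N x x := by
  have hx : x ∈ Submodule.span ℝ (Set.range (algTprod (H := H) (N := N))) := by
    rw [span_algTprod]; trivial
  obtain ⟨n, c, g, rfl⟩ := Submodule.mem_span_set'.mp hx
  choose f hf using fun a => (g a).2
  have h := (posSemidef_prod_gram f Finset.univ).dotProduct_mulVec_nonneg c
  simp only [← hf, map_sum, LinearMap.sum_apply, map_smul, LinearMap.smul_apply,
    tensorForm_tprod, smul_eq_mul]
  refine h.trans_eq ?_
  simp only [dotProduct, Matrix.mulVec, Matrix.of_apply, Finset.mul_sum]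
  simp
  rw [Finset.sum_comm]
  refine Finset.sum_congr rfl fun a _ => Finset.sum_congr rfl fun b _ => by
    ring

variable (H N)

/-- The inner product on the algebraic tensor power given by `tensorForm`. -/
@[reducible]
def tensorCore : PreInnerProductSpace.Core ℝ (AlgTensorPower H N) where
  inner x y := tensorForm H N x y
  conj_inner_symm x y := tensorForm_symm y x
  re_inner_nonneg x := tensorForm_nonneg x
  add_left x y z := by simp
  smul_left x y r := by simp

instance : SeminormedAddCommGroup (AlgTensorPower H N) :=
  @InnerProductSpace.Core.toSeminormedAddCommGroup ℝ _ _ _ _ (tensorCore H N)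

instance : InnerProductSpace ℝ (AlgTensorPower H N) :=
  InnerProductSpace.ofCore (tensorCore H N)

/-- The Hilbert space tensor power `H(N)`: the completion of the algebraic tensor power for the
inner product with `⟨g₁ ⊗ ⋯ ⊗ g_N, h₁ ⊗ ⋯ ⊗ h_N⟩ = ∏ⱼ ⟨gⱼ, hⱼ⟩`. -/
abbrev TensorPower : Type _ := UniformSpace.Completion (AlgTensorPower H N)

variable {H N}

/-- The pure tensor `h₁ ⊗ ⋯ ⊗ h_N ∈ H(N)`. -/
def tprod : MultilinearMap ℝ (fun _ : Fin N => H) (TensorPower H N) :=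
  (UniformSpace.Completion.toComplL (𝕜 := ℝ) (E := AlgTensorPower H N)).toLinearMap.compMultilinearMap
    algTprod

theorem inner_tprod (g h : Fin N → H) : ⟪tprod g, tprod h⟫ = ∏ j, ⟪g j, h j⟫ := by
  change ⟪((algTprod g : AlgTensorPower H N) : TensorPower H N),
    ((algTprod h : AlgTensorPower H N) : TensorPower H N)⟫ = _
  rw [UniformSpace.Completion.inner_coe]
  exact tensorForm_tprod g h

theorem norm_tprod (g : Fin N → H) : ‖(tprod g : TensorPower H N)‖ = ∏ j, ‖g j‖ := by
  rw [← Real.sqrt_sq (norm_nonneg _), ← real_inner_self_eq_norm_sq, inner_tprod]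
  simp only [real_inner_self_eq_norm_sq, Finset.prod_pow]
  exact Real.sqrt_sq (Finset.prod_nonneg fun _ _ => norm_nonneg _)

theorem orthonormal_tprod {ι : Type*} (b : HilbertBasis ι ℝ H) :
    Orthonormal ℝ (fun i : Fin N → ι => (tprod fun j => b (i j) : TensorPower H N)) := by
  classical
  rw [orthonormal_iff_ite]
  intro i i'
  rw [inner_tprod]
  rw [Finset.prod_congr rfl fun j _ => orthonormal_iff_ite.mp b.orthonormal (i j) (i' j),
    Fintype.prod_ite_zero]
  simp only [funext_iff, Finset.prod_const_one]

theorem eq_zero_of_inner_tprod {v : TensorPower H N}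
    (hv : ∀ f : Fin N → H, ⟪v, tprod f⟫ = 0) : v = 0 := by
  have hall : ∀ x : TensorPower H N, ⟪v, x⟫ = 0 := by
    intro x
    induction x using UniformSpace.Completion.induction_on with
    | hp => exact isClosed_eq (by fun_prop) continuous_const
    | ih x =>
      have hx : x ∈ Submodule.span ℝ (Set.range (algTprod (H := H) (N := N))) := by
        rw [span_algTprod]; trivial
      induction hx using Submodule.span_induction with
      | mem x hx => obtain ⟨f, rfl⟩ := hx; exact hv f
      | zero => exact inner_zero_right v
      | add x y _ _ h1 h2 => rw [UniformSpace.Completion.coe_add, inner_add_right, h1, h2, add_zero]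
      | smul r x _ h => rw [UniformSpace.Completion.coe_smul, inner_smul_right, h, mul_zero]
  exact inner_self_eq_zero.mp (hall v)

theorem inner_tprod_eq_zero_of_basis {ι : Type*} (b : HilbertBasis ι ℝ H) {v : TensorPower H N}
    (hv : ∀ i : Fin N → ι, ⟪v, tprod fun j => b (i j)⟫ = 0) (s : Finset (Fin N)) :
    ∀ f : Fin N → H, (∀ j ∉ s, f j ∈ Set.range b) → ⟪v, tprod f⟫ = 0 := by
  classical
  induction s using Finset.induction_on with
  | empty =>
    intro f hf
    choose i hi using fun j => hf j (Finset.notMem_empty j)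
    rw [show f = fun j => b (i j) from funext fun j => (hi j).symm]
    exact hv i
  | insert k s hk ih =>
    intro f hf
    let g₀ : H →ₗ[ℝ] ℝ := (innerₛₗ ℝ v) ∘ₗ (tprod (H := H) (N := N)).toLinearMap f k
    have hg₀ : ∀ h, g₀ h = ⟪v, tprod (Function.update f k h)⟫ := fun h => rfl
    let g : H →L[ℝ] ℝ := g₀.mkContinuous (‖v‖ * ∏ j ∈ Finset.univ.erase k, ‖f j‖) (by
      intro h
      rw [hg₀]
      refine (norm_inner_le_norm _ _).trans (le_of_eq ?_)
      rw [norm_tprod, ← Finset.mul_prod_erase _ _ (Finset.mem_univ k), Function.update_self,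
        mul_assoc, mul_comm ‖h‖]
      congr 2
      refine Finset.prod_congr rfl fun j hj => ?_
      rw [Function.update_of_ne (Finset.ne_of_mem_erase hj)])
    have hgz : g = 0 := by
      refine ContinuousLinearMap.ext_on (s := Set.range b) ?_ ?_
      · have := b.dense_span
        rw [Submodule.dense_iff_topologicalClosure_eq_top]
        exact this
      · rintro _ ⟨i, rfl⟩
        change ⟪v, tprod (Function.update f k (b i))⟫ = 0
        refine ih _ fun j hj => ?_
        by_cases hjk : j = k
        · subst hjk; simp
        · rw [Function.update_of_ne hjk]
          exact hf j (by simp [hjk, hj])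
    have := DFunLike.congr_fun hgz (f k)
    change ⟪v, tprod (Function.update f k (f k))⟫ = 0 at this
    rwa [Function.update_eq_self] at this

/-- The orthonormal basis `φ_{i₁} ⊗ ⋯ ⊗ φ_{i_N}`, indexed by multi-indices, of `H(N)`. -/
def tensorBasis {ι : Type*} (b : HilbertBasis ι ℝ H) (N : ℕ) :
    HilbertBasis (Fin N → ι) ℝ (TensorPower H N) :=
  HilbertBasis.mkOfOrthogonalEqBot (orthonormal_tprod b) (by
    rw [Submodule.eq_bot_iff]
    intro v hv
    refine eq_zero_of_inner_tprod fun f =>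
      inner_tprod_eq_zero_of_basis b (fun i => ?_) Finset.univ f (by simp)
    rw [real_inner_comm]
    exact hv _ (Submodule.subset_span ⟨i, rfl⟩))

theorem tensorBasis_apply {ι : Type*} (b : HilbertBasis ι ℝ H) (i : Fin N → ι) :
    tensorBasis b N i = tprod fun j => b (i j) := by
  simp [tensorBasis]

end TensorPower

/-! ### Spaces normed by weighted sums of squares of Fourier coefficients -/

section Weighted

variable {ι : Type*} {K : Type*} [NormedAddCommGroup K] [InnerProductSpace ℝ K]

/-- The elements `v` of `K` with `∑ᵢ wᵢ ⟨bᵢ, v⟩² < ∞`. -/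
def weightedSubmodule (b : HilbertBasis ι ℝ K) (w : ι → ℝ) (hw : ∀ i, 0 < w i) :
    Submodule ℝ K where
  carrier := {v | Summable fun i => w i * ⟪b i, v⟫ ^ 2}
  zero_mem' := by simp [summable_zero]
  add_mem' := by
    intro u v hu hv
    refine Summable.of_nonneg_of_le (fun i => mul_nonneg (hw i).le (sq_nonneg _)) (fun i => ?_)
      ((hu.add hv).mul_left 2)
    rw [inner_add_right]
    nlinarith [mul_nonneg (hw i).le (sq_nonneg (⟪b i, u⟫ - ⟪b i, v⟫))]
  smul_mem' := by
    intro c v hv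
    refine (hv.mul_left (c ^ 2)).congr fun i => ?_
    rw [inner_smul_right]
    ring

/-- The space `{v ∈ K : ∑ᵢ wᵢ ⟨bᵢ, v⟩² < ∞}` with the norm `‖v‖² = ∑ᵢ wᵢ ⟨bᵢ, v⟩²`. -/
def WeightedSpace (b : HilbertBasis ι ℝ K) (w : ι → ℝ) (hw : ∀ i, 0 < w i) : Type _ :=
  weightedSubmodule b w hw

namespace WeightedSpace

variable (b : HilbertBasis ι ℝ K) (w : ι → ℝ) (hw : ∀ i, 0 < w i)

/-- The isometric coordinates `v ↦ (√wᵢ ⟨bᵢ, v⟩)ᵢ ∈ ℓ²`. -/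
def coord : weightedSubmodule b w hw →ₗ[ℝ] lp (fun _ : ι => ℝ) 2 where
  toFun v := ⟨fun i => √(w i) * ⟪b i, (v : K)⟫, by
    refine memℓp_gen ?_
    have h : Summable fun i => w i * ⟪b i, (v : K)⟫ ^ 2 := v.2
    refine h.congr fun i => ?_
    simp [mul_pow, Real.sq_sqrt (hw i).le]⟩
  map_add' u v := by
    ext i
    change √(w i) * ⟪b i, (u : K) + v⟫ = √(w i) * ⟪b i, (u : K)⟫ + √(w i) * ⟪b i, (v : K)⟫
    rw [inner_add_right, mul_add]
  map_smul' c v := by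
    ext i
    change √(w i) * ⟪b i, c • (v : K)⟫ = c * (√(w i) * ⟪b i, (v : K)⟫)
    rw [inner_smul_right]
    ring

theorem coord_apply (v : weightedSubmodule b w hw) (i : ι) :
    coord b w hw v i = √(w i) * ⟪b i, (v : K)⟫ := rfl

theorem coord_injective : Function.Injective (coord b w hw) := by
  rw [injective_iff_map_eq_zero]
  intro v hv
  have h0 : ∀ i, ⟪b i, (v : K)⟫ = 0 := fun i => by
    have h1 : coord b w hw v i = 0 := by rw [hv]; rfl
    rw [coord_apply] at h1
    exact (mul_eq_zero.mp h1).resolve_left (Real.sqrt_ne_zero'.mpr (hw i))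
  have h2 : (v : K) = 0 := by
    have h3 := b.hasSum_repr (v : K)
    simp only [b.repr_apply_apply, h0, zero_smul] at h3
    exact h3.unique hasSum_zero
  exact Subtype.ext h2

instance : NormedAddCommGroup (WeightedSpace b w hw) :=
  NormedAddCommGroup.induced (weightedSubmodule b w hw) _ (coord b w hw) (coord_injective b w hw)

instance : InnerProductSpace ℝ (WeightedSpace b w hw) where
  __ := (inferInstance : Module ℝ (weightedSubmodule b w hw))
  norm_smul_le := fun (c : ℝ) (v : weightedSubmodule b w hw) => by
    change ‖coord b w hw (c • v)‖ ≤ ‖c‖ * ‖coord b w hw v‖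
    rw [map_smul, norm_smul]
  inner u v := ⟪coord b w hw u, coord b w hw v⟫
  norm_sq_eq_re_inner v := norm_sq_eq_re_inner (𝕜 := ℝ) (coord b w hw v)
  conj_inner_symm u v := inner_conj_symm (coord b w hw u) (coord b w hw v)
  add_left := fun (u v x : weightedSubmodule b w hw) => by
    change ⟪coord b w hw (u + v), coord b w hw x⟫ =
      ⟪coord b w hw u, coord b w hw x⟫ + ⟪coord b w hw v, coord b w hw x⟫
    rw [map_add, inner_add_left]
  smul_left := fun (u v : weightedSubmodule b w hw) (c : ℝ) => by
    change ⟪coord b w hw (c • u), coord b w hw v⟫ = _ * ⟪coord b w hw u, coord b w hw v⟫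
    rw [map_smul, inner_smul_left]

/-- The inclusion into the ambient space `K`. -/
def incl : WeightedSpace b w hw →ₗ[ℝ] K where
  toFun v := (weightedSubmodule b w hw).subtype v
  map_add' _ _ := rfl
  map_smul' _ _ := rfl

theorem norm_sq_eq (v : WeightedSpace b w hw) :
    ‖v‖ ^ 2 = ∑' i, w i * ⟪b i, incl b w hw v⟫ ^ 2 := by
  change ‖coord b w hw v‖ ^ 2 = _
  rw [← real_inner_self_eq_norm_sq, lp.inner_eq_tsum]
  refine tsum_congr fun i => ?_
  rw [real_inner_self_eq_norm_sq, Real.norm_eq_abs, sq_abs]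
  change (√(w i) * ⟪b i, incl b w hw v⟫) ^ 2 = _
  rw [mul_pow, Real.sq_sqrt (hw i).le]

theorem norm_incl_le {c : ℝ} (hc : 0 < c) (h : ∀ i, c ≤ w i) (v : WeightedSpace b w hw) :
    ‖incl b w hw v‖ ≤ (√c)⁻¹ * ‖v‖ := by
  have hs : Summable fun i => w i * ⟪b i, incl b w hw v⟫ ^ 2 := v.2
  have h1 : c * ‖incl b w hw v‖ ^ 2 ≤ ‖v‖ ^ 2 := by
    have h2 : HasSum (fun i => c * ⟪b i, incl b w hw v⟫ ^ 2) (c * ‖incl b w hw v‖ ^ 2) := by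
      have h3 := (b.hasSum_inner_mul_inner (incl b w hw v) (incl b w hw v)).mul_left c
      rw [real_inner_self_eq_norm_sq] at h3
      refine h3.congr_fun fun i => ?_
      rw [real_inner_comm (b i), sq]
    rw [norm_sq_eq, ← h2.tsum_eq]
    exact h2.summable.tsum_le_tsum
      (fun i => mul_le_mul_of_nonneg_right (h i) (sq_nonneg _)) hs
  have h4 := Real.sqrt_le_sqrt h1
  rw [Real.sqrt_mul hc.le, Real.sqrt_sq (norm_nonneg _), Real.sqrt_sq (norm_nonneg _)] at h4
  rw [inv_mul_eq_div, le_div_iff₀ (Real.sqrt_pos.mpr hc), mul_comm]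
  exact h4

end WeightedSpace

end Weighted

/-! ### The Bochner space `W(0, T; X, Y)` -/

section Bochner

/-- The time interval `(0, T)`, where `T ∈ (0, ∞]`. -/
def timeInterval (T : EReal) : Set ℝ := {t | 0 < t ∧ (t : EReal) < T}

/-- The Lebesgue measure on `(0, T)`. -/
def timeMeasure (T : EReal) : Measure ℝ := volume.restrict (timeInterval T)

variable {X Y : Type*} [NormedAddCommGroup X] [NormedSpace ℝ X]
  [NormedAddCommGroup Y] [NormedSpace ℝ Y]

/-- `y'` is the weak derivative of `y` on `(0, T)`, where `y` takes values in `X`, `y'` takes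
values in `Y`, and `X` is embedded in `Y` by `e`:
`∫ ψ'(t) y(t) dt = - ∫ ψ(t) y'(t) dt` in `Y` for all `ψ ∈ C_c^∞(0, T)`. -/
def HasWeakDeriv (T : EReal) (e : X →L[ℝ] Y) (y : ℝ → X) (y' : ℝ → Y) : Prop :=
  ∀ ψ : ℝ → ℝ, ContDiff ℝ ∞ ψ → HasCompactSupport ψ → tsupport ψ ⊆ timeInterval T →
    ∫ t, deriv ψ t • e (y t) ∂timeMeasure T = - ∫ t, ψ t • y' t ∂timeMeasure T

theorem isOpen_timeInterval (T : EReal) : IsOpen (timeInterval T) :=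
  (isOpen_lt continuous_const continuous_id).inter
    (isOpen_lt continuous_coe_real_ereal continuous_const)

/-- Weak derivatives are unique almost everywhere. -/
theorem HasWeakDeriv.unique [CompleteSpace Y] {T : EReal} {e : X →L[ℝ] Y} {y : ℝ → X}
    {y₁ y₂ : Lp Y 2 (timeMeasure T)} (h₁ : HasWeakDeriv T e y y₁) (h₂ : HasWeakDeriv T e y y₂) :
    y₁ = y₂ := by
  have hm : MeasurableSet (timeInterval T) := (isOpen_timeInterval T).measurableSet
  have hli : ∀ f : Lp Y 2 (timeMeasure T), LocallyIntegrable f (timeMeasure T) := fun f =>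
    haveI : IsLocallyFiniteMeasure (timeMeasure T) := by unfold timeMeasure; infer_instance
    (Lp.memLp f).locallyIntegrable (by norm_num)
  have key : ∀ᵐ t ∂volume.restrict (timeInterval T), t ∈ timeInterval T → y₁ t - y₂ t = 0 := by
    refine (isOpen_timeInterval T).ae_eq_zero_of_integral_contDiff_smul_eq_zero
      (((hli y₁).sub (hli y₂)).locallyIntegrableOn _) fun ψ hψ hc hs => ?_
    have hi : ∀ f : Lp Y 2 (timeMeasure T), Integrable (fun t => ψ t • f t) (timeMeasure T) :=
      fun f => (hli f).integrable_smul_left_of_hasCompactSupport hψ.continuous hc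
    have h := neg_injective ((h₁ ψ hψ hc hs).symm.trans (h₂ ψ hψ hc hs))
    simp only [smul_sub]
    change ∫ t, (ψ t • y₁ t - ψ t • y₂ t) ∂timeMeasure T = 0
    rw [integral_sub (hi y₁) (hi y₂), h, sub_self]
  refine Lp.ext ?_
  have hmem : ∀ᵐ t ∂volume.restrict (timeInterval T), t ∈ timeInterval T := ae_restrict_mem hm
  change ∀ᵐ t ∂volume.restrict (timeInterval T), y₁ t = y₂ t
  filter_upwards [key, hmem] with t ht hmt
  exact sub_eq_zero.mp (ht hmt)

/-- The space `W(0, T; X, Y) = {y ∈ L²(0, T; X) | y' ∈ L²(0, T; Y)}`; an element is recorded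
together with its weak derivative (unique by `HasWeakDeriv.unique`). -/
structure BochnerW (T : EReal) (e : X →L[ℝ] Y) where
  /-- the function `y ∈ L²(0, T; X)` -/
  toLp : Lp X 2 (timeMeasure T)
  /-- its weak derivative `y' ∈ L²(0, T; Y)` -/
  weakDeriv : Lp Y 2 (timeMeasure T)
  hasWeakDeriv : HasWeakDeriv T e toLp weakDeriv

/-- `‖y‖²_{W(0, T; X, Y)} = ‖y‖²_{L²(0, T; X)} + ‖y'‖²_{L²(0, T; Y)}`. -/
def BochnerW.norm {T : EReal} {e : X →L[ℝ] Y} (y : BochnerW T e) : ℝ :=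
  √(‖y.toLp‖ ^ 2 + ‖y.weakDeriv‖ ^ 2)

end Bochner

/-! ### The Gelfand triple `(V, H, V')` and the space `V_1^0(N)` -/

section Triple

variable {H : Type*} [NormedAddCommGroup H] [InnerProductSpace ℝ H] [CompleteSpace H]

variable (H) in
/-- A positive self-adjoint (hence closed and densely defined) operator `L` in `H`, with an
orthonormal basis `(φᵢ)` of `H` of eigenvectors and eigenvalues `(λᵢ)`. The last field says that
`‖v‖_H ≤ C ‖L^{1/2} v‖_H`, i.e. that `V = D(L^{1/2})` embeds continuously in `H`. -/
structure EigenOperator where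
  L : H →ₗ.[ℝ] H
  isSelfAdjoint : IsSelfAdjoint L
  pos : ∀ v : L.domain, v ≠ 0 → 0 < ⟪L v, (v : H)⟫
  φ : HilbertBasis ℕ ℝ H
  eig : ℕ → ℝ
  φ_mem : ∀ i, φ i ∈ L.domain
  L_φ : ∀ i, L ⟨φ i, φ_mem i⟩ = eig i • φ i
  embed : ∃ C : ℝ, ∀ v : L.domain, ‖(v : H)‖ ^ 2 ≤ C * ⟪L v, (v : H)⟫

namespace EigenOperator

variable (D : EigenOperator H)

theorem inner_L_φ (i : ℕ) : ⟪D.L ⟨D.φ i, D.φ_mem i⟩, D.φ i⟫ = D.eig i := by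
  rw [D.L_φ, inner_smul_left, real_inner_self_eq_norm_sq, D.φ.orthonormal.1 i]
  simp

theorem eig_pos (i : ℕ) : 0 < D.eig i := by
  rw [← D.inner_L_φ i]
  refine D.pos ⟨D.φ i, D.φ_mem i⟩ fun h => ?_
  exact D.φ.orthonormal.ne_zero i (congrArg Subtype.val h)

theorem exists_le_eig : ∃ c : ℝ, 0 < c ∧ ∀ i, c ≤ D.eig i := by
  obtain ⟨C, hC⟩ := D.embed
  have h : ∀ i, 1 ≤ C * D.eig i := fun i => by
    have h1 := hC ⟨D.φ i, D.φ_mem i⟩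
    rw [D.inner_L_φ i, D.φ.orthonormal.1 i] at h1
    simpa using h1
  have hCpos : 0 < C := by
    by_contra hn
    nlinarith [h 0, D.eig_pos 0]
  exact ⟨C⁻¹, inv_pos.mpr hCpos, fun i => by
    rw [inv_le_iff_one_le_mul₀ hCpos, mul_comm]; exact h i⟩

/-- `V = D(L^{1/2}) = {v ∈ H | ∑ᵢ λᵢ ⟨φᵢ, v⟩² < ∞}` with
`‖v‖²_V = ‖L^{1/2} v‖²_H = ∑ᵢ λᵢ ⟨φᵢ, v⟩²`. -/
abbrev V : Type _ := WeightedSpace D.φ D.eig D.eig_pos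

/-- The topological dual `V'` with the dual norm. -/
abbrev V' : Type _ := StrongDual ℝ D.V

/-- The embedding `V ↪ H`. -/
def VtoH : D.V →L[ℝ] H :=
  (WeightedSpace.incl D.φ D.eig D.eig_pos).mkContinuousOfExistsBound (by
    obtain ⟨c, hc, h⟩ := D.exists_le_eig
    exact ⟨(√c)⁻¹, WeightedSpace.norm_incl_le _ _ _ hc h⟩)

/-- The embedding `V ↪ H ≅ H' ↪ V'`, `⟨v, w⟩_V = (v, w)_H`. -/
def VtoV' : D.V →L[ℝ] D.V' :=
  ((ContinuousLinearMap.compL ℝ D.V H ℝ).flip D.VtoH) ∘L (innerSL ℝ) ∘L D.VtoH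

theorem VtoV'_apply (v w : D.V) : D.VtoV' v w = ⟪D.VtoH v, D.VtoH w⟫ := rfl

/-- `σ(λ_i) = λ_{i₁} + ⋯ + λ_{i_N}` for a multi-index `i ∈ ℕ^N`. -/
def sumEig (N : ℕ) (i : Fin N → ℕ) : ℝ := ∑ l, D.eig (i l)

theorem sumEig_pos (N : ℕ) [NeZero N] (i : Fin N → ℕ) : 0 < D.sumEig N i :=
  Finset.sum_pos (fun l _ => D.eig_pos (i l)) ⟨0, Finset.mem_univ _⟩

/-- The space `V_1^0(N)` of all `v ∈ H(N)` with finite norm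
`‖v‖² = ∑_{i ∈ ℕ^N} (λ_{i₁} + ⋯ + λ_{i_N}) ⟨φ_{i₁} ⊗ ⋯ ⊗ φ_{i_N}, v⟩²`; see `mem_V10_iff` for its
description as an intersection. -/
abbrev V10 (N : ℕ) [NeZero N] : Type _ :=
  WeightedSpace (tensorBasis D.φ N) (D.sumEig N) (D.sumEig_pos N)

/-- The inclusion of `V_1^0(N)` in `H(N)`. -/
abbrev V10toH (N : ℕ) [NeZero N] : D.V10 N →ₗ[ℝ] TensorPower H N :=
  WeightedSpace.incl (tensorBasis D.φ N) (D.sumEig N) (D.sumEig_pos N)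

/-- `V_1^0(N)` is the intersection over `l` of the spaces `H ⊗ ⋯ ⊗ V ⊗ ⋯ ⊗ H` with the factor `V`
in place `l`. -/
theorem mem_V10_iff (N : ℕ) [NeZero N] (v : TensorPower H N) :
    v ∈ Set.range (D.V10toH N) ↔
      ∀ l : Fin N, Summable fun i : Fin N → ℕ =>
        D.eig (i l) * ⟪(tprod fun j => D.φ (i j) : TensorPower H N), v⟫ ^ 2 := by
  have h0 : v ∈ Set.range (D.V10toH N) ↔
      v ∈ weightedSubmodule (tensorBasis D.φ N) (D.sumEig N) (D.sumEig_pos N) :=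
    ⟨fun ⟨x, hx⟩ => hx ▸ x.2, fun h => ⟨⟨v, h⟩, rfl⟩⟩
  rw [h0]
  change (Summable fun i => D.sumEig N i * ⟪tensorBasis D.φ N i, v⟫ ^ 2) ↔ _
  simp only [tensorBasis_apply, sumEig, Finset.sum_mul]
  refine ⟨fun h l => ?_, fun h => summable_sum fun l _ => h l⟩
  have hn : ∀ (i : Fin N → ℕ) (m : Fin N),
      0 ≤ D.eig (i m) * ⟪(tprod fun j => D.φ (i j) : TensorPower H N), v⟫ ^ 2 :=
    fun i m => mul_nonneg (D.eig_pos _).le (sq_nonneg _)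
  exact Summable.of_nonneg_of_le (fun i => hn i l)
    (fun i => Finset.single_le_sum (fun m _ => hn i m) (Finset.mem_univ l)) h

/-- `y` is the continuous representative `[0, T) → H` of `z ∈ W(0, T; V, V')`, so that
`z(0) = y 0`. -/
def IsContRep {T : EReal} (z : BochnerW T D.VtoV') (y : ℝ → H) : Prop :=
  ContinuousOn y {t : ℝ | 0 ≤ t ∧ (t : EReal) < T} ∧
    ∀ᵐ t ∂timeMeasure T, y t = D.VtoH (z.toLp t)

end EigenOperator

end Triple

end Carleman

end

/-!
Write `zᵢ(t) = ⟨φᵢ, z(t)⟩` for the modes of `z`. Evaluating the weak derivative, an element of `V'`,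
at `φᵢ` shows that `zᵢ` has the weak derivative `t ↦ z'(t) φᵢ` in `L²(0, T)`, so by the lemma of
du Bois-Reymond (`exists_ae_eq_primitive`) it has an absolutely continuous representative `Yᵢ`.
Since `2 |Yᵢ Yᵢ'| ≤ λᵢ Yᵢ² + λᵢ⁻¹ Yᵢ'²`, the fundamental theorem of calculus for `Yᵢ²` gives

  `Yᵢ(t)² ≤ Yᵢ(s)² + eᵢ`, where `eᵢ = ∫ (λᵢ zᵢ² + λᵢ⁻¹ zᵢ'²)` (`sq_primitive_le`),

for all `s, t ∈ [0, T)`. By the definition of the norm of `V` and Bessel's inequality in `V'`,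
`∑ᵢ eᵢ ≤ ‖z‖²_W` (`sum_modeEnergy_le`). Two facts follow.

* The squares of the modes are dominated by a summable sequence, uniformly in time, so the `Yᵢ` are
  the coordinates of a continuous function `[0, T) → H` (`exists_continuousOn_of_coords`,
  `exists_isContRep`). Neither the density of smooth functions in `W(0, T; V, V')` nor the
  integration by parts formula for the triple `(V, H, V')` is needed.
* Summing over `i` with `s = 0` gives `‖z(t)‖²_H ≤ ‖z(0)‖²_H + ‖z‖²_W` (`IsContRep.norm_sq_le`).

The norm of a tensor power is explicit: `‖v ⊗ ⋯ ⊗ v‖² = N ‖v‖_V² ‖v‖_H^{2(N-1)}` in `V_1^0(N)`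
(`norm_tprodV_const`), because the weight `λ_{i_l}` in the defining sum amounts to applying
`L^{1/2}` to the factor `l`, and Parseval's identity applies to the resulting pure tensor. The
pure tensor map is a bounded multilinear map from `V` to `V_1^0(N)`, whence measurability, and
integrating the norm identity against the supremum bound gives the estimate.
-/

namespace Carleman

/-! ### Scalar functions with an integrable weak derivative -/

theorem mem_timeInterval_of_le {T : EReal} {a b : ℝ} (ha : 0 < a) (hab : a ≤ b)
    (hb : b ∈ timeInterval T) : a ∈ timeInterval T :=
  ⟨ha, (EReal.coe_le_coe_iff.mpr hab).trans_lt hb.2⟩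

theorem exists_mem_timeInterval {T : EReal} (hT : 0 < T) : ∃ t, t ∈ timeInterval T := by
  obtain ⟨x, h0, hx⟩ := EReal.lt_iff_exists_real_btwn.mp hT
  exact ⟨x, EReal.coe_pos.mp h0, hx⟩

theorem exists_subset_Icc_of_subset_timeInterval {T : EReal} (hT : 0 < T) {K : Set ℝ}
    (hK : IsCompact K) (hKT : K ⊆ timeInterval T) :
    ∃ a b : ℝ, 0 < a ∧ a ≤ b ∧ b ∈ timeInterval T ∧ K ⊆ Set.Icc a b := by
  rcases K.eq_empty_or_nonempty with rfl | hne
  · obtain ⟨t, ht⟩ := exists_mem_timeInterval hT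
    exact ⟨t, t, ht.1, le_rfl, ht, Set.empty_subset _⟩
  · obtain ⟨a, ha⟩ := hK.exists_isLeast hne
    obtain ⟨b, hb⟩ := hK.exists_isGreatest hne
    exact ⟨a, b, (hKT ha.1).1, ha.2 hb.1, hKT hb.1, fun x hx => ⟨ha.2 hx, hb.2 hx⟩⟩

/-- A test function of mean zero on `(0, T)` is the derivative of a test function on `(0, T)`. -/
theorem exists_testFunction_deriv_eq {T : EReal} (hT : 0 < T) {ψ : ℝ → ℝ}
    (hψ : ContDiff ℝ ∞ ψ) (hc : HasCompactSupport ψ) (hs : tsupport ψ ⊆ timeInterval T)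
    (h0 : ∫ t, ψ t = 0) :
    ∃ χ : ℝ → ℝ, ContDiff ℝ ∞ χ ∧ HasCompactSupport χ ∧ tsupport χ ⊆ timeInterval T ∧
      deriv χ = ψ := by
  obtain ⟨a, b, ha, hab, hb, hsub⟩ := exists_subset_Icc_of_subset_timeInterval hT hc hs
  have hder : ∀ t, HasDerivAt (fun t => ∫ s in (0 : ℝ)..t, ψ s) (ψ t) t := fun t =>
    intervalIntegral.integral_hasDerivAt_right (hψ.continuous.intervalIntegrable _ _)
      (hψ.continuous.stronglyMeasurableAtFilter _ _) hψ.continuous.continuousAt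
  have hderiv : deriv (fun t => ∫ s in (0 : ℝ)..t, ψ s) = ψ := funext fun t => (hder t).deriv
  have hz : ∀ t, t ∉ Set.Icc a b → ψ t = 0 := fun t ht =>
    image_eq_zero_of_notMem_tsupport fun h => ht (hsub h)
  have hsupp : Function.support (fun t => ∫ s in (0 : ℝ)..t, ψ s) ⊆ Set.Icc a b := by
    intro t ht
    by_contra hn
    apply ht
    rw [Set.mem_Icc, not_and_or, not_le, not_le] at hn
    rcases hn with h | h
    · refine intervalIntegral.integral_zero_ae (Eventually.of_forall fun s hs => hz s fun h' => ?_)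
      rcases Set.mem_uIoc.mp hs with h2 | h2
      · linarith [h2.2, h'.1]
      · linarith [h2.2, h'.1]
    · change ∫ s in (0 : ℝ)..t, ψ s = 0
      rw [intervalIntegral.integral_eq_integral_of_support_subset, h0]
      intro s hs
      have : s ∈ Set.Icc a b := by
        by_contra h'
        exact hs (hz s h')
      exact ⟨by linarith [this.1], by linarith [this.2]⟩
  have ht : tsupport (fun t => ∫ s in (0 : ℝ)..t, ψ s) ⊆ Set.Icc a b :=
    closure_minimal hsupp isClosed_Icc
  refine ⟨fun t => ∫ s in (0 : ℝ)..t, ψ s, ?_, ?_, ?_, hderiv⟩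
  · rw [contDiff_infty_iff_deriv, hderiv]
    exact ⟨fun t => (hder t).differentiableAt, hψ⟩
  · exact HasCompactSupport.intro isCompact_Icc fun t h => by
      by_contra h'
      exact h (hsupp h')
  · exact ht.trans fun t h => mem_timeInterval_of_le (ha.trans_le h.1) h.2 hb

theorem intervalIntegrable_of_locallyIntegrable {G : ℝ → ℝ} (hG : LocallyIntegrable G volume)
    (a b : ℝ) : IntervalIntegrable G volume a b :=
  (hG.integrableOn_isCompact isCompact_uIcc).intervalIntegrable

/-- Integration by parts of a primitive against a test function. -/
theorem integral_deriv_mul_primitive {T : EReal} (hT : 0 < T) {G : ℝ → ℝ}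
    (hG : LocallyIntegrable G volume) {χ : ℝ → ℝ} (hχ : ContDiff ℝ ∞ χ)
    (hc : HasCompactSupport χ) (hs : tsupport χ ⊆ timeInterval T) :
    ∫ t, deriv χ t * (∫ s in (0 : ℝ)..t, G s) ∂timeMeasure T =
      - ∫ t, χ t * G t ∂timeMeasure T := by
  obtain ⟨a, b, ha, hab, hb, hsub⟩ := exists_subset_Icc_of_subset_timeInterval hT hc hs
  have hz : ∀ t, t ∉ Set.Icc a b → χ t = 0 := fun t ht =>
    image_eq_zero_of_notMem_tsupport fun h => ht (hsub h)
  have hz' : ∀ t, t ∉ Set.Icc a b → deriv χ t = 0 := fun t ht =>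
    image_eq_zero_of_notMem_tsupport fun h => ht (hsub (tsupport_deriv_subset h))
  have hsubT : Set.Icc a b ⊆ timeInterval T := fun t h =>
    mem_timeInterval_of_le (ha.trans_le h.1) h.2 hb
  -- Both integrals are integrals over `(0, b + 1]`, at whose end points `χ` vanishes.
  have conv : ∀ F : ℝ → ℝ, (∀ t, t ∉ Set.Icc a b → F t = 0) →
      ∫ t, F t ∂timeMeasure T = ∫ t in (0 : ℝ)..(b + 1), F t := by
    intro F hF
    rw [timeMeasure, setIntegral_eq_integral_of_forall_compl_eq_zero
      fun t ht => hF t fun h => ht (hsubT h),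
      intervalIntegral.integral_eq_integral_of_support_subset]
    intro t ht
    have : t ∈ Set.Icc a b := by
      by_contra h'
      exact ht (hF t h')
    exact ⟨by linarith [this.1], by linarith [this.2]⟩
  rw [conv _ fun t ht => by rw [hz' t ht, zero_mul], conv _ fun t ht => by rw [hz t ht, zero_mul]]
  have hacχ : AbsolutelyContinuousOnInterval χ 0 (b + 1) :=
    (hχ.of_le (by simp)).contDiffOn.absolutelyContinuousOnInterval
  have hacY : AbsolutelyContinuousOnInterval (fun t => ∫ s in (0 : ℝ)..t, G s) 0 (b + 1) :=
    (intervalIntegrable_of_locallyIntegrable hG _ _).absolutelyContinuousOnInterval_intervalIntegral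
      (by simp)
  have key := hacχ.integral_mul_deriv_eq_deriv_mul hacY
  have hG' : ∫ t in (0 : ℝ)..(b + 1), χ t * deriv (fun t => ∫ s in (0 : ℝ)..t, G s) t =
      ∫ t in (0 : ℝ)..(b + 1), χ t * G t := by
    refine intervalIntegral.integral_congr_ae ?_
    filter_upwards [(LocallyIntegrable.ae_hasDerivAt_integral hG)] with t ht _
    rw [(ht 0).deriv]
  rw [hG', hz (b + 1) (fun h => by linarith [h.2])] at key
  simp only [intervalIntegral.integral_same, mul_zero, zero_mul, zero_sub, sub_self] at key
  linarith

/-- A locally integrable function with a locally integrable weak derivative `G` is almost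
everywhere a primitive of `G` (the lemma of du Bois-Reymond). -/
theorem exists_ae_eq_primitive {T : EReal} (hT : 0 < T) {f G : ℝ → ℝ}
    (hf : LocallyIntegrable f (timeMeasure T)) (hG : LocallyIntegrable G volume)
    (h : ∀ ψ : ℝ → ℝ, ContDiff ℝ ∞ ψ → HasCompactSupport ψ → tsupport ψ ⊆ timeInterval T →
      ∫ t, deriv ψ t * f t ∂timeMeasure T = - ∫ t, ψ t * G t ∂timeMeasure T) :
    ∃ c : ℝ, ∀ᵐ t ∂timeMeasure T, f t = c + ∫ s in (0 : ℝ)..t, G s := by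
  set Y : ℝ → ℝ := fun t => ∫ s in (0 : ℝ)..t, G s with hY
  have hYc : Continuous Y :=
    intervalIntegral.continuous_primitive (intervalIntegrable_of_locallyIntegrable hG) 0
  have : IsLocallyFiniteMeasure (timeMeasure T) := by unfold timeMeasure; infer_instance
  have hd : LocallyIntegrable (fun t => f t - Y t) (timeMeasure T) :=
    hf.sub hYc.locallyIntegrable
  have hint : ∀ ψ : ℝ → ℝ, Continuous ψ → HasCompactSupport ψ → ∀ F : ℝ → ℝ,
      LocallyIntegrable F (timeMeasure T) → Integrable (fun t => ψ t * F t) (timeMeasure T) :=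
    fun ψ h1 h2 F hF => hF.integrable_smul_left_of_hasCompactSupport h1 h2
  have hmean : ∀ ψ : ℝ → ℝ, ContDiff ℝ ∞ ψ → HasCompactSupport ψ →
      tsupport ψ ⊆ timeInterval T → ∫ t, ψ t = 0 →
      ∫ t, ψ t * (f t - Y t) ∂timeMeasure T = 0 := by
    intro ψ hψ hc hs h0
    obtain ⟨χ, h1, h2, h3, rfl⟩ := exists_testFunction_deriv_eq hT hψ hc hs h0
    simp only [mul_sub]
    rw [integral_sub (hint _ hψ.continuous hc f hf)
      (hint _ hψ.continuous hc Y hYc.locallyIntegrable), h χ h1 h2 h3,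
      integral_deriv_mul_primitive hT hG h1 h2 h3, sub_self]
  -- A test function `ρ` of integral one; subtracting `(∫ ψ) ρ` from `ψ` makes its mean zero.
  obtain ⟨t₀, ht₀⟩ := exists_mem_timeInterval hT
  obtain ⟨ε, hε, hball⟩ := Metric.isOpen_iff.mp (isOpen_timeInterval T) t₀ ht₀
  let β : ContDiffBump t₀ := ⟨ε / 4, ε / 2, by linarith, by linarith⟩
  set ρ : ℝ → ℝ := β.normed volume with hρ
  have hρ1 : ∫ t, ρ t = 1 := β.integral_normed
  have hρs : ContDiff ℝ ∞ ρ := β.contDiff_normed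
  have hρc : HasCompactSupport ρ := β.hasCompactSupport_normed
  have hρt : tsupport ρ ⊆ timeInterval T := by
    rw [hρ, β.tsupport_normed_eq]
    exact (Metric.closedBall_subset_ball (by change ε / 2 < ε; linarith)).trans hball
  set c : ℝ := ∫ t, ρ t * (f t - Y t) ∂timeMeasure T with hcdef
  have hvol : ∀ ψ : ℝ → ℝ, tsupport ψ ⊆ timeInterval T →
      ∫ t, ψ t ∂timeMeasure T = ∫ t, ψ t := fun ψ hs =>
    setIntegral_eq_integral_of_forall_compl_eq_zero fun t ht =>
      image_eq_zero_of_notMem_tsupport fun h' => ht (hs h')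
  have key : ∀ᵐ t ∂timeMeasure T, t ∈ timeInterval T → f t - Y t - c = 0 := by
    refine (isOpen_timeInterval T).ae_eq_zero_of_integral_contDiff_smul_eq_zero
      ((hd.sub (locallyIntegrable_const c)).locallyIntegrableOn _) fun ψ hψ hc hs => ?_
    set m : ℝ := ∫ t, ψ t with hm
    have hsm : ContDiff ℝ ∞ fun t => ψ t - m * ρ t := hψ.sub (contDiff_const.mul hρs)
    have heq : (fun t => ψ t - m * ρ t) = ψ + (fun _ => -m) * ρ := by
      funext t
      simp only [Pi.add_apply, Pi.mul_apply]
      ring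
    have hcm : HasCompactSupport fun t => ψ t - m * ρ t := by
      rw [heq]
      exact hc.add hρc.mul_left
    have htm : tsupport (fun t => ψ t - m * ρ t) ⊆ timeInterval T := by
      rw [heq]
      exact (tsupport_add _ _).trans
        (Set.union_subset hs ((tsupport_mul_subset_right).trans hρt))
    have hz := hmean (fun t => ψ t - m * ρ t) hsm hcm htm ?_
    · have e : ∀ t, (ψ t - m * ρ t) * (f t - Y t) =
          ψ t * (f t - Y t) - m * (ρ t * (f t - Y t)) := fun t => by ring
      simp only [e] at hz
      rw [integral_sub (hint _ hψ.continuous hc _ hd)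
        ((hint _ hρs.continuous hρc _ hd).const_mul m), integral_const_mul, ← hcdef] at hz
      have e2 : ∀ t, ψ t • (f t - Y t - c) = ψ t * (f t - Y t) - c * ψ t := fun t => by
        rw [smul_eq_mul]; ring
      change ∫ t, ψ t • (f t - Y t - c) ∂timeMeasure T = 0
      simp only [e2]
      rw [integral_sub (hint _ hψ.continuous hc _ hd)
        ((hψ.continuous.integrable_of_hasCompactSupport hc).const_mul c), integral_const_mul,
        hvol ψ hs]
      linarith
    · rw [integral_sub (hψ.continuous.integrable_of_hasCompactSupport hc)
        ((hρs.continuous.integrable_of_hasCompactSupport hρc).const_mul m), integral_const_mul,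
        hρ1, mul_one, sub_self]
  refine ⟨c, ?_⟩
  have hmem : ∀ᵐ t ∂timeMeasure T, t ∈ timeInterval T :=
    ae_restrict_mem (isOpen_timeInterval T).measurableSet
  filter_upwards [key, hmem] with t h1 h2
  linarith [h1 h2]

/-- The energy estimate for one scalar mode: the weight `l` balances the function and its
derivative in `2 |Y Y'| ≤ l Y² + l⁻¹ Y'²`. -/
theorem sq_primitive_le {T : EReal} {f G : ℝ → ℝ} {c l : ℝ} (hl : 0 < l)
    (hG : LocallyIntegrable G volume)
    (hf : ∀ᵐ t ∂timeMeasure T, f t = c + ∫ s in (0 : ℝ)..t, G s)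
    (hi : Integrable (fun t => l * f t ^ 2 + l⁻¹ * G t ^ 2) (timeMeasure T))
    {s t : ℝ} (hs : 0 ≤ s) (hsT : (s : EReal) < T) (ht : 0 ≤ t) (htT : (t : EReal) < T) :
    (c + ∫ r in (0 : ℝ)..t, G r) ^ 2 ≤ (c + ∫ r in (0 : ℝ)..s, G r) ^ 2 +
      ∫ r, (l * f r ^ 2 + l⁻¹ * G r ^ 2) ∂timeMeasure T := by
  set Y : ℝ → ℝ := fun t => c + ∫ s in (0 : ℝ)..t, G s with hY
  have hac : AbsolutelyContinuousOnInterval Y s t := by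
    have h1 : AbsolutelyContinuousOnInterval (fun x => ∫ r in s..x, G r) s t :=
      (intervalIntegrable_of_locallyIntegrable hG _ _).absolutelyContinuousOnInterval_intervalIntegral
        (by simp)
    have h2 : AbsolutelyContinuousOnInterval (fun _ : ℝ => c + ∫ r in (0 : ℝ)..s, G r) s t :=
      contDiff_const.contDiffOn.absolutelyContinuousOnInterval
    have e : Y = (fun _ : ℝ => c + ∫ r in (0 : ℝ)..s, G r) + fun x => ∫ r in s..x, G r := by
      funext x
      simp only [hY, Pi.add_apply]
      rw [add_assoc, intervalIntegral.integral_add_adjacent_intervals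
        (intervalIntegrable_of_locallyIntegrable hG _ _)
        (intervalIntegrable_of_locallyIntegrable hG _ _)]
    rw [e]
    exact h2.add h1
  have hftc := hac.integral_deriv_mul_eq_sub hac
  have hsub : Set.uIoc s t ⊆ timeInterval T := by
    intro r hr
    rcases Set.mem_uIoc.mp hr with h | h
    · exact ⟨hs.trans_lt h.1, (EReal.coe_le_coe_iff.mpr h.2).trans_lt htT⟩
    · exact ⟨ht.trans_lt h.1, (EReal.coe_le_coe_iff.mpr h.2).trans_lt hsT⟩
  have hle : volume.restrict (Set.uIoc s t) ≤ timeMeasure T := Measure.restrict_mono_set _ hsub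
  have hnn : ∀ r, 0 ≤ l * f r ^ 2 + l⁻¹ * G r ^ 2 := fun r => by positivity
  have hbound : ‖∫ x in s..t, deriv Y x * Y x + Y x * deriv Y x‖ ≤
      ∫ r, (l * f r ^ 2 + l⁻¹ * G r ^ 2) ∂timeMeasure T := by
    refine intervalIntegral.norm_integral_le_integral_norm_uIoc.trans ?_
    refine le_trans (integral_mono_of_nonneg (Eventually.of_forall fun _ => norm_nonneg _)
      (hi.mono_measure hle) ?_)
      (integral_mono_measure hle (Eventually.of_forall hnn) hi)
    filter_upwards [ae_restrict_of_ae (LocallyIntegrable.ae_hasDerivAt_integral hG),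
      (Measure.absolutelyContinuous_of_le hle).ae_le hf] with r h1 h2
    have h3 : deriv Y r = G r := ((h1 0).const_add c).deriv
    have h4 : f r = Y r := h2
    rw [h3, h4, Real.norm_eq_abs, abs_le]
    -- Completing the square: `l Y² ± 2 Y G + l⁻¹ G² = l (Y ± l⁻¹ G)²`.
    have hli : l * l⁻¹ = 1 := mul_inv_cancel₀ hl.ne'
    have e1 : l * Y r ^ 2 + l⁻¹ * G r ^ 2 + 2 * (Y r * G r) = l * (Y r + l⁻¹ * G r) ^ 2 := by
      linear_combination (-2 * Y r * G r - l⁻¹ * G r ^ 2) * hli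
    have e2 : l * Y r ^ 2 + l⁻¹ * G r ^ 2 - 2 * (Y r * G r) = l * (Y r - l⁻¹ * G r) ^ 2 := by
      linear_combination (2 * Y r * G r - l⁻¹ * G r ^ 2) * hli
    have p1 : 0 ≤ l * (Y r + l⁻¹ * G r) ^ 2 := by positivity
    have p2 : 0 ≤ l * (Y r - l⁻¹ * G r) ^ 2 := by positivity
    constructor <;> linarith
  rw [hftc] at hbound
  have := (le_abs_self _).trans hbound
  change Y t ^ 2 ≤ Y s ^ 2 + _
  linarith

/-! ### Continuity of Hilbert space valued functions from their coordinates -/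

/-- Coordinates that are continuous and dominated by a summable sequence, uniformly in `t`, are the
coordinates of a continuous function with values in the Hilbert space. -/
theorem exists_continuousOn_of_coords {ι K X : Type*} [NormedAddCommGroup K]
    [InnerProductSpace ℝ K] [TopologicalSpace X] (b : HilbertBasis ι ℝ K) {S : Set X}
    {Y : ι → X → ℝ} {M : ι → ℝ} (hM : Summable M) (hY : ∀ i, ContinuousOn (Y i) S)
    (hle : ∀ i, ∀ t ∈ S, Y i t ^ 2 ≤ M i) :
    ∃ y : X → K, ContinuousOn y S ∧ ∀ t ∈ S, ∀ i, ⟪b i, y t⟫ = Y i t := by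
  classical
  have hmem : ∀ t ∈ S, Memℓp (fun i => Y i t) 2 := fun t ht => by
    refine memℓp_gen ?_
    refine Summable.of_nonneg_of_le (fun i => by positivity) (fun i => ?_) hM
    simpa using hle i t ht
  let y : X → K := fun t => if h : Memℓp (fun i => Y i t) 2 then b.repr.symm ⟨_, h⟩ else 0
  have hy : ∀ t ∈ S, ∀ i, ⟪b i, y t⟫ = Y i t := by
    intro t ht i
    simp only [y, dif_pos (hmem t ht)]
    rw [← b.repr_apply_apply, LinearIsometryEquiv.apply_symm_apply]
  refine ⟨y, fun t₀ ht₀ => ?_, hy⟩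
  have hnorm : ∀ t ∈ S, ‖y t - y t₀‖ ^ 2 = ∑' i, (Y i t - Y i t₀) ^ 2 := by
    intro t ht
    have h := b.hasSum_inner_mul_inner (y t - y t₀) (y t - y t₀)
    rw [real_inner_self_eq_norm_sq] at h
    rw [← h.tsum_eq]
    refine tsum_congr fun i => ?_
    rw [real_inner_comm, inner_sub_right, hy t ht, hy t₀ ht₀, sq]
  have hlim : Tendsto (fun t => ∑' i, (Y i t - Y i t₀) ^ 2) (𝓝[S] t₀) (𝓝 (∑' _ : ι, (0 : ℝ))) := by
    refine tendsto_tsum_of_dominated_convergence (hM.mul_left 4) (fun i => ?_) ?_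
    · have h : Tendsto (Y i) (𝓝[S] t₀) (𝓝 (Y i t₀)) := hY i t₀ ht₀
      have h2 := (h.sub_const (Y i t₀)).pow 2
      rwa [sub_self, zero_pow two_ne_zero] at h2
    · filter_upwards [self_mem_nhdsWithin] with t ht i
      rw [Real.norm_eq_abs, abs_of_nonneg (sq_nonneg _)]
      nlinarith [hle i t ht, hle i t₀ ht₀, sq_nonneg (Y i t + Y i t₀)]
  rw [tsum_zero] at hlim
  have hlim' : Tendsto (fun t => ‖y t - y t₀‖ ^ 2) (𝓝[S] t₀) (𝓝 0) := by
    refine hlim.congr' ?_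
    filter_upwards [self_mem_nhdsWithin] with t ht
    exact (hnorm t ht).symm
  rw [ContinuousWithinAt, tendsto_iff_norm_sub_tendsto_zero]
  have h2 := hlim'.sqrt
  simpa [Real.sqrt_sq] using h2

/-! ### The `L²` norm -/

theorem Lp_two_norm_sq {α E : Type*} [MeasurableSpace α] {μ : Measure α} [NormedAddCommGroup E]
    (f : Lp E 2 μ) : ‖f‖ ^ 2 = ∫ t, ‖f t‖ ^ 2 ∂μ := by
  have h := (Lp.memLp f).eLpNorm_eq_integral_rpow_norm (by norm_num) (by norm_num)
  rw [Lp.norm_def, h, ENNReal.toReal_ofReal (by positivity)]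
  simp only [ENNReal.toReal_ofNat, Real.rpow_ofNat]
  rw [← Real.rpow_natCast, ← Real.rpow_mul (by positivity)]
  norm_num

/-! ### Coordinates in `V` and `V'` -/

namespace EigenOperator

variable {H : Type*} [NormedAddCommGroup H] [InnerProductSpace ℝ H] [CompleteSpace H]
  (D : EigenOperator H)

theorem summable_eig_mul_inner_sq (v : D.V) :
    Summable fun i => D.eig i * ⟪D.φ i, D.VtoH v⟫ ^ 2 := v.2

theorem norm_sq_V (v : D.V) : ‖v‖ ^ 2 = ∑' i, D.eig i * ⟪D.φ i, D.VtoH v⟫ ^ 2 :=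
  WeightedSpace.norm_sq_eq _ _ _ v

theorem sum_eig_mul_inner_sq_le (F : Finset ℕ) (v : D.V) :
    ∑ i ∈ F, D.eig i * ⟪D.φ i, D.VtoH v⟫ ^ 2 ≤ ‖v‖ ^ 2 := by
  rw [norm_sq_V]
  exact (D.summable_eig_mul_inner_sq v).sum_le_tsum F
    fun i _ => mul_nonneg (D.eig_pos i).le (sq_nonneg _)

/-- The eigenvector `φᵢ` as an element of `V`. -/
noncomputable def φV (i : ℕ) : D.V :=
  ⟨D.φ i, by
    classical
    refine summable_of_ne_finset_zero (s := {i}) fun j hj => ?_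
    rw [orthonormal_iff_ite.mp D.φ.orthonormal j i, if_neg (by simpa using hj)]
    simp⟩

theorem VtoH_φV (i : ℕ) : D.VtoH (D.φV i) = D.φ i := rfl

/-- Bessel's inequality in `V'`, where the `φᵢ / √λᵢ` form an orthonormal system of `V`. It follows
by testing `g` with `∑ i ∈ F, (g φᵢ / λᵢ) φᵢ`. -/
theorem sum_inv_eig_mul_sq_le (F : Finset ℕ) (g : D.V') :
    ∑ i ∈ F, (D.eig i)⁻¹ * g (D.φV i) ^ 2 ≤ ‖g‖ ^ 2 := by
  classical
  set S := ∑ i ∈ F, (D.eig i)⁻¹ * g (D.φV i) ^ 2 with hS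
  have hS0 : 0 ≤ S := Finset.sum_nonneg fun i _ =>
    mul_nonneg (inv_pos.mpr (D.eig_pos i)).le (sq_nonneg _)
  set v : D.V := ∑ i ∈ F, ((D.eig i)⁻¹ * g (D.φV i)) • D.φV i with hv
  have hgv : g v = S := by
    rw [hv, hS, map_sum]
    refine Finset.sum_congr rfl fun i _ => ?_
    rw [map_smul, smul_eq_mul]
    ring
  have hcoef : ∀ j, ⟪D.φ j, D.VtoH v⟫ = if j ∈ F then (D.eig j)⁻¹ * g (D.φV j) else 0 := by
    intro j
    rw [hv, map_sum, inner_sum]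
    simp only [map_smul, VtoH_φV, inner_smul_right, orthonormal_iff_ite.mp D.φ.orthonormal j]
    simp
  have hvn : ‖v‖ ^ 2 = S := by
    rw [norm_sq_V, tsum_eq_sum (s := F), hS]
    · refine Finset.sum_congr rfl fun i hi => ?_
      rw [hcoef, if_pos hi]
      have := (D.eig_pos i).ne'
      field_simp
    · intro j hj
      rw [hcoef, if_neg hj]
      simp
  have h1 : S ≤ ‖g‖ * ‖v‖ := by
    rw [← hgv]
    exact (le_abs_self _).trans (g.le_opNorm v)
  nlinarith [norm_nonneg g, norm_nonneg v, sq_nonneg (‖g‖ - ‖v‖)]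

/-! ### Tensor powers of elements of `V` -/

/-- The vector `L^{1/2} v ∈ H` of an element `v` of `V`. -/
noncomputable def sqrtL (v : D.V) : H :=
  D.φ.repr.symm (WeightedSpace.coord D.φ D.eig D.eig_pos v)

theorem inner_φ_sqrtL (i : ℕ) (v : D.V) :
    ⟪D.φ i, D.sqrtL v⟫ = √(D.eig i) * ⟪D.φ i, D.VtoH v⟫ := by
  rw [← D.φ.repr_apply_apply, sqrtL, LinearIsometryEquiv.apply_symm_apply]
  rfl

theorem norm_sqrtL (v : D.V) : ‖D.sqrtL v‖ = ‖v‖ := by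
  rw [sqrtL, LinearIsometryEquiv.norm_map]
  rfl

/-- Parseval's identity for the tensor product in which `L^{1/2}` acts on the factor `l` only. -/
theorem hasSum_eig_mul_inner_tprod_sq {N : ℕ} (l : Fin N) (v : Fin N → D.V) :
    HasSum (fun i : Fin N → ℕ => D.eig (i l) *
        ⟪tensorBasis D.φ N i, (tprod fun j => D.VtoH (v j) : TensorPower H N)⟫ ^ 2)
      (‖v l‖ ^ 2 * ∏ j ∈ Finset.univ.erase l, ‖D.VtoH (v j)‖ ^ 2) := by
  set x : Fin N → H := Function.update (fun j => D.VtoH (v j)) l (D.sqrtL (v l)) with hx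
  have h := (tensorBasis D.φ N).hasSum_inner_mul_inner (tprod x) (tprod x)
  have hne : ∀ j ∈ Finset.univ.erase l, x j = D.VtoH (v j) := fun j hj =>
    Function.update_of_ne (Finset.ne_of_mem_erase hj) _ _
  have hl : x l = D.sqrtL (v l) := Function.update_self _ _ _
  have hsum : ‖v l‖ ^ 2 * ∏ j ∈ Finset.univ.erase l, ‖D.VtoH (v j)‖ ^ 2 =
      ⟪(tprod x : TensorPower H N), tprod x⟫ := by
    rw [real_inner_self_eq_norm_sq, norm_tprod, ← Finset.prod_pow,
      ← Finset.mul_prod_erase _ _ (Finset.mem_univ l), hl, norm_sqrtL]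
    congr 1
    exact Finset.prod_congr rfl fun j hj => by rw [hne j hj]
  rw [hsum]
  refine h.congr_fun fun i => ?_
  have hrest : ∏ j ∈ Finset.univ.erase l, ⟪D.φ (i j), x j⟫ =
      ∏ j ∈ Finset.univ.erase l, ⟪D.φ (i j), D.VtoH (v j)⟫ :=
    Finset.prod_congr rfl fun j hj => by rw [hne j hj]
  rw [real_inner_comm (tensorBasis D.φ N i), ← sq, tensorBasis_apply, inner_tprod, inner_tprod,
    ← Finset.mul_prod_erase _ _ (Finset.mem_univ l),
    ← Finset.mul_prod_erase _ (fun j => ⟪D.φ (i j), x j⟫) (Finset.mem_univ l), hl,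
    inner_φ_sqrtL, hrest, mul_pow, mul_pow, mul_pow, Real.sq_sqrt (D.eig_pos _).le]
  ring

variable (N : ℕ)

theorem hasSum_sumEig_mul_inner_tprod_sq (v : Fin N → D.V) :
    HasSum (fun i : Fin N → ℕ => D.sumEig N i *
        ⟪tensorBasis D.φ N i, (tprod fun j => D.VtoH (v j) : TensorPower H N)⟫ ^ 2)
      (∑ l, ‖v l‖ ^ 2 * ∏ j ∈ Finset.univ.erase l, ‖D.VtoH (v j)‖ ^ 2) := by
  simp only [sumEig, Finset.sum_mul]
  exact hasSum_sum fun l _ => D.hasSum_eig_mul_inner_tprod_sq l v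

variable [NeZero N]

/-- The pure tensor `v₁ ⊗ ⋯ ⊗ v_N` of elements of `V`, as an element of `V_1^0(N)`. -/
noncomputable def tprodV : MultilinearMap ℝ (fun _ : Fin N => D.V) (D.V10 N) where
  toFun v := ⟨tprod fun j => D.VtoH (v j), (D.hasSum_sumEig_mul_inner_tprod_sq N v).summable⟩
  map_update_add' := fun {_} v i x y => Subtype.ext <| by
    exact ((tprod (H := H) (N := N)).compLinearMap
      fun _ => (D.VtoH : D.V →ₗ[ℝ] H)).map_update_add v i x y
  map_update_smul' := fun {_} v i c x => Subtype.ext <| by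
    exact ((tprod (H := H) (N := N)).compLinearMap
      fun _ => (D.VtoH : D.V →ₗ[ℝ] H)).map_update_smul v i c x

theorem V10toH_tprodV (v : Fin N → D.V) :
    D.V10toH N (D.tprodV N v) = tprod fun j => D.VtoH (v j) := rfl

theorem norm_sq_tprodV (v : Fin N → D.V) :
    ‖D.tprodV N v‖ ^ 2 = ∑ l, ‖v l‖ ^ 2 * ∏ j ∈ Finset.univ.erase l, ‖D.VtoH (v j)‖ ^ 2 := by
  rw [WeightedSpace.norm_sq_eq]
  exact (D.hasSum_sumEig_mul_inner_tprod_sq N v).tsum_eq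

theorem norm_tprodV_const (v : D.V) :
    ‖D.tprodV N fun _ => v‖ = √N * ‖D.VtoH v‖ ^ (N - 1) * ‖v‖ := by
  have h : ‖D.tprodV N fun _ => v‖ ^ 2 = (√N * ‖D.VtoH v‖ ^ (N - 1) * ‖v‖) ^ 2 := by
    rw [norm_sq_tprodV, mul_pow, mul_pow, Real.sq_sqrt (Nat.cast_nonneg N)]
    simp only [Finset.prod_const, Finset.card_erase_of_mem (Finset.mem_univ _), Finset.card_univ,
      Fintype.card_fin, Finset.sum_const, nsmul_eq_mul]
    ring
  exact (sq_eq_sq₀ (norm_nonneg _) (by positivity)).mp h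

theorem continuous_tprodV : Continuous (D.tprodV N) := by
  have hbound : ∀ v, ‖D.tprodV N v‖ ≤ √N * ‖D.VtoH‖ ^ (N - 1) * ∏ j, ‖v j‖ := by
    intro v
    rw [← sq_le_sq₀ (norm_nonneg _) (by positivity), norm_sq_tprodV, mul_pow, mul_pow,
      Real.sq_sqrt (Nat.cast_nonneg N)]
    have hl : ∀ l ∈ Finset.univ, ‖v l‖ ^ 2 * ∏ j ∈ Finset.univ.erase l, ‖D.VtoH (v j)‖ ^ 2 ≤
        (‖D.VtoH‖ ^ (N - 1)) ^ 2 * (∏ j, ‖v j‖) ^ 2 := by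
      intro l hl
      have h : ∏ j ∈ Finset.univ.erase l, ‖D.VtoH (v j)‖ ^ 2 ≤
          ∏ j ∈ Finset.univ.erase l, ‖D.VtoH‖ ^ 2 * ‖v j‖ ^ 2 :=
        Finset.prod_le_prod (fun j _ => sq_nonneg _) fun j _ => by
          rw [← mul_pow]
          exact pow_le_pow_left₀ (norm_nonneg _) (D.VtoH.le_opNorm _) 2
      refine (mul_le_mul_of_nonneg_left h (sq_nonneg _)).trans_eq ?_
      rw [Finset.prod_mul_distrib, Finset.prod_const, Finset.card_erase_of_mem hl,
        Finset.card_univ, Fintype.card_fin, ← Finset.prod_pow,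
        ← Finset.mul_prod_erase _ (fun j => ‖v j‖ ^ 2) hl]
      ring
    refine (Finset.sum_le_sum hl).trans_eq ?_
    rw [Finset.sum_const, Finset.card_univ, Fintype.card_fin, nsmul_eq_mul, mul_assoc]
  exact ((D.tprodV N).mkContinuous _ hbound).cont

end EigenOperator

theorem BochnerW.norm_sq_eq {X Y : Type*} [NormedAddCommGroup X] [NormedSpace ℝ X]
    [NormedAddCommGroup Y] [NormedSpace ℝ Y] {T : EReal} {e : X →L[ℝ] Y} (z : BochnerW T e) :
    z.norm ^ 2 = ‖z.toLp‖ ^ 2 + ‖z.weakDeriv‖ ^ 2 :=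
  Real.sq_sqrt (by positivity)

namespace EigenOperator

/-! ### The modes of an element of `W(0, T; V, V')` -/

variable {H : Type*} [NormedAddCommGroup H] [InnerProductSpace ℝ H] [CompleteSpace H]
  (D : EigenOperator H) {T : EReal} (z : BochnerW T D.VtoV')

/-- The share `∫ (λᵢ zᵢ² + λᵢ⁻¹ zᵢ'²)` of the mode `i` in `‖z‖²_{W(0, T; V, V')}`. -/
noncomputable def modeEnergy (i : ℕ) : ℝ :=
  ∫ t, (D.eig i * ⟪D.φ i, D.VtoH (z.toLp t)⟫ ^ 2 + (D.eig i)⁻¹ * z.weakDeriv t (D.φV i) ^ 2)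
    ∂timeMeasure T

theorem memLp_mode (i : ℕ) :
    MemLp (fun t => ⟪D.φ i, D.VtoH (z.toLp t)⟫) 2 (timeMeasure T) :=
  ((innerSL ℝ (D.φ i)) ∘L D.VtoH).comp_memLp' (Lp.memLp z.toLp)

theorem memLp_modeDeriv (i : ℕ) :
    MemLp (fun t => z.weakDeriv t (D.φV i)) 2 (timeMeasure T) :=
  (ContinuousLinearMap.apply ℝ ℝ (D.φV i)).comp_memLp' (Lp.memLp z.weakDeriv)

theorem integrable_modeEnergy (i : ℕ) :
    Integrable (fun t => D.eig i * ⟪D.φ i, D.VtoH (z.toLp t)⟫ ^ 2 +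
      (D.eig i)⁻¹ * z.weakDeriv t (D.φV i) ^ 2) (timeMeasure T) :=
  ((D.memLp_mode z i).integrable_sq.const_mul _).add
    ((D.memLp_modeDeriv z i).integrable_sq.const_mul _)

theorem modeEnergy_nonneg (i : ℕ) : 0 ≤ D.modeEnergy z i :=
  integral_nonneg fun _ => add_nonneg (mul_nonneg (D.eig_pos i).le (sq_nonneg _))
    (mul_nonneg (inv_pos.mpr (D.eig_pos i)).le (sq_nonneg _))

theorem sum_modeEnergy_le (F : Finset ℕ) : ∑ i ∈ F, D.modeEnergy z i ≤ z.norm ^ 2 := by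
  have h1 : Integrable (fun t => ‖z.toLp t‖ ^ 2) (timeMeasure T) :=
    (memLp_two_iff_integrable_sq_norm (Lp.aestronglyMeasurable _)).mp (Lp.memLp z.toLp)
  have h2 : Integrable (fun t => ‖z.weakDeriv t‖ ^ 2) (timeMeasure T) :=
    (memLp_two_iff_integrable_sq_norm (Lp.aestronglyMeasurable _)).mp (Lp.memLp z.weakDeriv)
  simp only [modeEnergy]
  rw [← integral_finsetSum _ fun i _ => D.integrable_modeEnergy z i, BochnerW.norm_sq_eq,
    Lp_two_norm_sq, Lp_two_norm_sq, ← integral_add h1 h2]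
  refine integral_mono (integrable_finsetSum _ fun i _ => D.integrable_modeEnergy z i)
    (h1.add h2) fun t => ?_
  simp only [Finset.sum_add_distrib]
  exact add_le_add (D.sum_eig_mul_inner_sq_le F _) (D.sum_inv_eig_mul_sq_le F _)

theorem summable_modeEnergy : Summable (D.modeEnergy z) :=
  summable_of_sum_le (D.modeEnergy_nonneg z) (D.sum_modeEnergy_le z)

/-- Evaluating the weak derivative at `φᵢ` gives the weak derivative of the mode `i`. -/
theorem integral_deriv_mul_mode (i : ℕ) {ψ : ℝ → ℝ} (hψ : ContDiff ℝ ∞ ψ)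
    (hc : HasCompactSupport ψ) (hs : tsupport ψ ⊆ timeInterval T) :
    ∫ t, deriv ψ t * ⟪D.φ i, D.VtoH (z.toLp t)⟫ ∂timeMeasure T =
      - ∫ t, ψ t * z.weakDeriv t (D.φV i) ∂timeMeasure T := by
  have : IsLocallyFiniteMeasure (timeMeasure T) := by unfold timeMeasure; infer_instance
  have h1 : Integrable (fun t => deriv ψ t • D.VtoV' (z.toLp t)) (timeMeasure T) :=
    ((D.VtoV'.comp_memLp' (Lp.memLp z.toLp)).locallyIntegrable
      (by norm_num)).integrable_smul_left_of_hasCompactSupport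
      (hψ.continuous_deriv (by simp)) hc.deriv
  have h2 : Integrable (fun t => ψ t • z.weakDeriv t) (timeMeasure T) :=
    ((Lp.memLp z.weakDeriv).locallyIntegrable
      (by norm_num)).integrable_smul_left_of_hasCompactSupport hψ.continuous hc
  have h := congrArg (fun g : D.V' => g (D.φV i)) (z.hasWeakDeriv ψ hψ hc hs)
  simp only [neg_apply] at h
  rw [ContinuousLinearMap.integral_apply h1, ContinuousLinearMap.integral_apply h2] at h
  simpa only [smul_apply, smul_eq_mul, VtoV'_apply, VtoH_φV,
    real_inner_comm (D.φ i)] using h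

/-- Each mode has a continuous representative, whose square varies by at most `modeEnergy`. -/
theorem exists_continuous_mode (hT : 0 < T) (i : ℕ) :
    ∃ Y : ℝ → ℝ, Continuous Y ∧ (∀ᵐ t ∂timeMeasure T, ⟪D.φ i, D.VtoH (z.toLp t)⟫ = Y t) ∧
      ∀ s t : ℝ, 0 ≤ s → (s : EReal) < T → 0 ≤ t → (t : EReal) < T →
        Y t ^ 2 ≤ Y s ^ 2 + D.modeEnergy z i := by
  have : IsLocallyFiniteMeasure (timeMeasure T) := by unfold timeMeasure; infer_instance
  have hm : MeasurableSet (timeInterval T) := (isOpen_timeInterval T).measurableSet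
  -- The derivative of the mode is extended by zero, to be locally integrable on all of `ℝ`.
  set G : ℝ → ℝ := (timeInterval T).indicator fun t => z.weakDeriv t (D.φV i) with hGdef
  have hG : LocallyIntegrable G volume :=
    ((memLp_indicator_iff_restrict hm).mpr (D.memLp_modeDeriv z i)).locallyIntegrable
      (by norm_num)
  have hGae : ∀ᵐ t ∂timeMeasure T, G t = z.weakDeriv t (D.φV i) :=
    indicator_ae_eq_restrict hm
  obtain ⟨c, hY⟩ := exists_ae_eq_primitive hT
    ((D.memLp_mode z i).locallyIntegrable (by norm_num)) hG fun ψ hψ hc hs => by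
      rw [D.integral_deriv_mul_mode z i hψ hc hs]
      congr 1
      refine integral_congr_ae ?_
      filter_upwards [hGae] with t ht
      rw [ht]
  have hae : (fun t => D.eig i * ⟪D.φ i, D.VtoH (z.toLp t)⟫ ^ 2 +
      (D.eig i)⁻¹ * z.weakDeriv t (D.φV i) ^ 2) =ᵐ[timeMeasure T]
      fun t => D.eig i * ⟪D.φ i, D.VtoH (z.toLp t)⟫ ^ 2 + (D.eig i)⁻¹ * G t ^ 2 := by
    filter_upwards [hGae] with t ht
    rw [ht]
  refine ⟨fun t => c + ∫ s in (0 : ℝ)..t, G s, ?_, hY, fun s t hs hsT ht htT => ?_⟩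
  · exact continuous_const.add (intervalIntegral.continuous_primitive
      (intervalIntegrable_of_locallyIntegrable hG) 0)
  · rw [modeEnergy, integral_congr_ae hae]
    exact sq_primitive_le (D.eig_pos i) hG hY ((D.integrable_modeEnergy z i).congr hae)
      hs hsT ht htT

/-! ### The continuous representative and its supremum bound -/

theorem eq_of_forall_inner_φ_eq {x y : H} (h : ∀ i, ⟪D.φ i, x⟫ = ⟪D.φ i, y⟫) : x = y := by
  apply D.φ.repr.injective
  ext i
  rw [D.φ.repr_apply_apply, D.φ.repr_apply_apply, h i]

theorem exists_isContRep (hT : 0 < T) : ∃ y : ℝ → H, D.IsContRep z y := by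
  choose Y hYc hYae hYle using D.exists_continuous_mode z hT
  have hae : ∀ᵐ t ∂timeMeasure T, ∀ i, ⟪D.φ i, D.VtoH (z.toLp t)⟫ = Y i t := ae_all_iff.mpr hYae
  have hmem : ∀ᵐ t ∂timeMeasure T, t ∈ timeInterval T :=
    ae_restrict_mem (isOpen_timeInterval T).measurableSet
  -- The coordinates are square summable at almost every time; one such time `s` suffices.
  have hne : (ae (timeMeasure T)).NeBot := by
    rw [ae_neBot, timeMeasure, Ne, Measure.restrict_eq_zero]
    exact ((isOpen_timeInterval T).measure_pos volume (exists_mem_timeInterval hT)).ne'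
  obtain ⟨s, hs, hsT⟩ := (hae.and hmem).exists
  have hsum : Summable fun i => Y i s ^ 2 + D.modeEnergy z i := by
    refine Summable.add ?_ (D.summable_modeEnergy z)
    have h := (D.φ.hasSum_inner_mul_inner (D.VtoH (z.toLp s)) (D.VtoH (z.toLp s))).summable
    refine h.congr fun i => ?_
    rw [real_inner_comm, hs i, sq]
  obtain ⟨y, hyc, hy⟩ := exists_continuousOn_of_coords D.φ hsum
    (S := {t : ℝ | 0 ≤ t ∧ (t : EReal) < T}) (fun i => (hYc i).continuousOn)
    fun i t ht => hYle i s t hsT.1.le hsT.2 ht.1 ht.2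
  refine ⟨y, hyc, ?_⟩
  filter_upwards [hae, hmem] with t h1 h2
  exact D.eq_of_forall_inner_φ_eq fun i => by rw [hy t ⟨h2.1.le, h2.2⟩ i, h1 i]

theorem Ico_subset_closure_timeInterval (hT : 0 < T) :
    {t : ℝ | 0 ≤ t ∧ (t : EReal) < T} ⊆ closure (timeInterval T) := by
  rintro t ⟨ht, htT⟩
  rcases ht.eq_or_lt with rfl | ht
  · obtain ⟨b, hb⟩ := exists_mem_timeInterval hT
    have h : Set.Ioo 0 b ⊆ timeInterval T := fun x hx => mem_timeInterval_of_le hx.1 hx.2.le hb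
    refine closure_mono h ?_
    rw [closure_Ioo hb.1.ne]
    exact ⟨le_rfl, hb.1.le⟩
  · exact subset_closure ⟨ht, htT⟩

/-- Summing the estimates of the modes: `‖z(t)‖²_H ≤ ‖z(0)‖²_H + ‖z‖²_W` on `[0, T)`. -/
theorem IsContRep.norm_sq_le {D : EigenOperator H} {z : BochnerW T D.VtoV'} {y : ℝ → H}
    (hy : D.IsContRep z y) (hT : 0 < T) {t : ℝ} (ht : 0 ≤ t) (htT : (t : EReal) < T) :
    ‖y t‖ ^ 2 ≤ ‖y 0‖ ^ 2 + z.norm ^ 2 := by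
  have hmode : ∀ i, ⟪D.φ i, y t⟫ ^ 2 ≤ ⟪D.φ i, y 0⟫ ^ 2 + D.modeEnergy z i := by
    intro i
    obtain ⟨Y, hYc, hYae, hYle⟩ := D.exists_continuous_mode z hT i
    have hsub : timeInterval T ⊆ {t : ℝ | 0 ≤ t ∧ (t : EReal) < T} := fun t h => ⟨h.1.le, h.2⟩
    have hc : ContinuousOn (fun t => ⟪D.φ i, y t⟫) {t : ℝ | 0 ≤ t ∧ (t : EReal) < T} :=
      continuousOn_const.inner hy.1
    have hae : (fun t => ⟪D.φ i, y t⟫) =ᵐ[volume.restrict (timeInterval T)] Y := by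
      filter_upwards [hy.2, hYae] with t h1 h2
      rw [h1, h2]
    have heq : Set.EqOn (fun t => ⟪D.φ i, y t⟫) Y {t : ℝ | 0 ≤ t ∧ (t : EReal) < T} :=
      (Measure.eqOn_open_of_ae_eq hae (isOpen_timeInterval T) (hc.mono hsub)
        hYc.continuousOn).of_subset_closure hc hYc.continuousOn hsub
        (Ico_subset_closure_timeInterval hT)
    have h0 : ((0 : ℝ) : EReal) < T := by simpa using hT
    rw [show ⟪D.φ i, y t⟫ = Y t from heq ⟨ht, htT⟩,
      show ⟪D.φ i, y 0⟫ = Y 0 from heq ⟨le_rfl, h0⟩]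
    exact hYle 0 t le_rfl h0 ht htT
  have hpars : ∀ x : H, HasSum (fun i => ⟪D.φ i, x⟫ ^ 2) (‖x‖ ^ 2) := fun x => by
    have h := D.φ.hasSum_inner_mul_inner x x
    rw [real_inner_self_eq_norm_sq] at h
    refine h.congr_fun fun i => ?_
    rw [real_inner_comm (D.φ i), sq]
  refine (hasSum_le hmode (hpars (y t)) ((hpars (y 0)).add
    (D.summable_modeEnergy z).hasSum)).trans ?_
  exact add_le_add_right (Real.tsum_le_of_sum_le (D.modeEnergy_nonneg z)
    (D.sum_modeEnergy_le z)) _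

end EigenOperator
end Carleman

/-! ### Tensor powers of elements of `W(0, T; V, V')` -/

theorem mainTheorem9 {H : Type*} [NormedAddCommGroup H] [InnerProductSpace ℝ H] [CompleteSpace H]
    (D : Carleman.EigenOperator H) (T : EReal) (hT : 0 < T)
    (z : Carleman.BochnerW T D.VtoV') :
    (∃ y : ℝ → H, D.IsContRep z y) ∧
    ∀ y : ℝ → H, D.IsContRep z y → ∀ (N : ℕ) [NeZero N],
      ∃ u : Lp (D.V10 N) 2 (Carleman.timeMeasure T),
        (∀ᵐ t ∂Carleman.timeMeasure T,
          D.V10toH N (u t) = Carleman.tprod fun _ : Fin N => D.VtoH (z.toLp t)) ∧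
        ‖u‖ ≤ √(N : ℝ) * (‖y 0‖ + z.norm) ^ N := by
  refine ⟨D.exists_isContRep z hT, fun y hy N _ => ?_⟩
  set K : ℝ := ‖y 0‖ + z.norm with hK
  have hz0 : 0 ≤ z.norm := Real.sqrt_nonneg _
  have hK0 : 0 ≤ K := add_nonneg (norm_nonneg _) hz0
  have hle : ∀ᵐ t ∂Carleman.timeMeasure T, ‖D.tprodV N fun _ => z.toLp t‖ ≤
      √(N : ℝ) * K ^ (N - 1) * ‖z.toLp t‖ := by
    have hmem : ∀ᵐ t ∂Carleman.timeMeasure T, t ∈ Carleman.timeInterval T :=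
      ae_restrict_mem (Carleman.isOpen_timeInterval T).measurableSet
    filter_upwards [hy.2, hmem] with t h1 h2
    have hsup : ‖D.VtoH (z.toLp t)‖ ≤ K := by
      rw [← h1]
      rw [← sq_le_sq₀ (norm_nonneg _) hK0]
      nlinarith [hy.norm_sq_le hT h2.1.le h2.2, mul_nonneg (norm_nonneg (y 0)) hz0]
    rw [D.norm_tprodV_const]
    gcongr
  have hmeas : AEStronglyMeasurable (fun t => D.tprodV N fun _ => z.toLp t)
      (Carleman.timeMeasure T) :=
    ((D.continuous_tprodV N).comp (continuous_pi fun _ => continuous_id)).comp_aestronglyMeasurable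
      (Lp.aestronglyMeasurable z.toLp)
  have hmemLp := (Lp.memLp z.toLp).of_le_mul hmeas hle
  refine ⟨hmemLp.toLp _, ?_, ?_⟩
  · filter_upwards [hmemLp.coeFn_toLp] with t ht
    rw [ht, D.V10toH_tprodV]
  · have hnorm : ‖hmemLp.toLp _‖ ≤ √(N : ℝ) * K ^ (N - 1) * ‖z.toLp‖ := by
      refine Lp.norm_le_mul_norm_of_ae_le_mul ?_
      filter_upwards [hmemLp.coeFn_toLp, hle] with t h1 h2
      rwa [h1]
    have hzK : ‖z.toLp‖ ≤ K := by
      refine le_trans ?_ (le_add_of_nonneg_left (norm_nonneg (y 0)))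
      refine Real.le_sqrt_of_sq_le ?_
      linarith [sq_nonneg ‖z.weakDeriv‖]
    calc ‖hmemLp.toLp _‖ ≤ √(N : ℝ) * K ^ (N - 1) * ‖z.toLp‖ := hnorm
      _ ≤ √(N : ℝ) * K ^ (N - 1) * K := by gcongr
      _ = √(N : ℝ) * K ^ N := by rw [mul_assoc, pow_sub_one_mul (NeZero.ne N)]
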